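/- Let $G$ be a connected (finite-dimensional, real, smooth) Lie group with Lie algebra $\mathfrak g$. Let $R$ be its solvable radical and $N$ its nilpotent radical, that is, the connected subgroups of $G$ generated by $\exp\mathfrak r$ and $\exp\mathfrak n$ respectively, where $\mathfrak r$ is the largest solvable ideal of $\mathfrak g$ and $\mathfrak n$ is the largest ideal of $\mathfrak g$ that is nilpotent as a Lie algebra. For $H\in\{G,R,N\}$ let $T(H)$ denote the largest torus (Lie subgroup isomorphic to $\mathbb R^n/\mathbb Z^n$ for some $n\ge 0$) contained in the center $Z(H)$ of $H$. Then these tori exist and coincide, as subgroups of $G$: $$T(G)=T(R)=T(N).$$ -/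

import Mathlib

open scoped Manifold ContDiff

noncomputable section

namespace LieToral

/-- The Lie bracket on the Lie algebra of a Lie group is defined in Mathlib under the regularity
assumption `minSmoothness ℝ 3`, which every smooth real Lie group satisfies. -/
instance instLieGroupMinSmoothness {d : ℕ} {G : Type*} [TopologicalSpace G]
    [ChartedSpace (EuclideanSpace ℝ (Fin d)) G] [Group G] [LieGroup (𝓡 d) ∞ G] :
    LieGroup (𝓡 d) (minSmoothness ℝ 3) G := by
  rw [minSmoothness_of_isRCLikeNormedField]
  infer_instance

/-- The nilpotent radical (nilradical) of a Lie algebra: the sum of all ideals that are nilpotent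
as Lie algebras; in finite dimension it is the largest such ideal. Mathlib's
`LieAlgebra.maxNilpotentIdeal` is a different ideal: it asks that the *whole* Lie algebra act
nilpotently on the ideal. -/
def nilradical (L : Type*) [LieRing L] [LieAlgebra ℝ L] : LieIdeal ℝ L :=
  sSup {J : LieIdeal ℝ L | LieRing.IsNilpotent J}

section LieGroup

variable {d : ℕ} {G : Type*} [TopologicalSpace G] [ChartedSpace (EuclideanSpace ℝ (Fin d)) G]
  [Group G]

/-- `IsExp X g` means `g = exp X`: the integral curve through `1` of the left-invariant vector
field with value `X` at `1` is at `g` at time `1`. -/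
def IsExp (X : GroupLieAlgebra (𝓡 d) G) (g : G) : Prop :=
  ∃ γ : ℝ → G, IsMIntegralCurve γ (mulInvariantVectorField (I := 𝓡 d) X) ∧ γ 0 = 1 ∧ γ 1 = g

/-- The connected subgroup of `G` generated by a set `𝔥` of elements of the Lie algebra, that is,
the subgroup generated by `exp 𝔥`. -/
def integralSubgroup (𝔥 : Set (GroupLieAlgebra (𝓡 d) G)) : Subgroup G :=
  Subgroup.closure {g : G | ∃ X ∈ 𝔥, IsExp X g}

/-- The solvable radical of a Lie group: the connected subgroup generated by the largest solvable
ideal of its Lie algebra. -/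
def solvableRadical (d : ℕ) (G : Type*) [TopologicalSpace G]
    [ChartedSpace (EuclideanSpace ℝ (Fin d)) G] [Group G] [LieGroup (𝓡 d) ∞ G] : Subgroup G :=
  integralSubgroup (d := d) (LieAlgebra.radical ℝ (GroupLieAlgebra (𝓡 d) G) : Set _)

/-- The nilpotent radical of a Lie group: the connected subgroup generated by the largest nilpotent
ideal of its Lie algebra. -/
def nilpotentRadical (d : ℕ) (G : Type*) [TopologicalSpace G]
    [ChartedSpace (EuclideanSpace ℝ (Fin d)) G] [Group G] [LieGroup (𝓡 d) ∞ G] : Subgroup G :=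
  integralSubgroup (d := d) (nilradical (GroupLieAlgebra (𝓡 d) G) : Set _)

/-- A subgroup `K` of a Lie group `G` is a torus if it is the image of an injective homomorphism of
Lie groups `ℝⁿ/ℤⁿ → G` for some `n` (which is automatically an isomorphism of Lie groups onto
`K`, by compactness). Such a homomorphism is given as a smooth homomorphism `ℝⁿ → G` with kernel
`ℤⁿ`. -/
def IsTorus (d : ℕ) {G : Type*} [TopologicalSpace G]
    [ChartedSpace (EuclideanSpace ℝ (Fin d)) G] [Group G] (K : Subgroup G) : Prop :=
  ∃ (n : ℕ) (f : (Fin n → ℝ) → G),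
    ContMDiff 𝓘(ℝ, Fin n → ℝ) (𝓡 d) ∞ f ∧
    (∀ x y, f (x + y) = f x * f y) ∧
    (∀ x, f x = 1 ↔ ∀ i, ∃ m : ℤ, x i = m) ∧
    Set.range f = (K : Set G)

/-- The center `Z(H)` of a subgroup `H` of `G`, as a subgroup of `G`. -/
def centerOf {G : Type*} [Group G] (H : Subgroup G) : Subgroup G :=
  (Subgroup.center H).map H.subtype

/-- `T(H)`, the toral component of a subgroup `H` of `G`: the subgroup generated by all tori
contained in the center of `H`. It is the largest such torus as soon as it is a torus. -/
def toralComponent (d : ℕ) {G : Type*} [TopologicalSpace G]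
    [ChartedSpace (EuclideanSpace ℝ (Fin d)) G] [Group G] (H : Subgroup G) : Subgroup G :=
  sSup {K : Subgroup G | IsTorus d K ∧ K ≤ centerOf H}

end LieGroup

end LieToral

end

/-!
The product of two commuting tori is a torus, so `Z(H)` has a greatest torus `T(H)`; for `H`
normal it is normal in `G`. Rigidity of tori makes it central in `G`: conjugation by the connected
group `G` permutes the finite set of elements of `T(H)` killed by `m`, hence acts trivially on it,
and the torsion is dense in `T(H)`. Conversely, a torus in `Z(G)` is the image under `exp` of
vectors that are central in the Lie algebra, and these lie in its nilradical; so `T(G)` is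
contained in `N`, hence in `R`, and in the center of both.
-/

noncomputable section

namespace LieToral

open Set Filter Topology VectorField

section Derivatives

variable {𝕜 : Type*} [NontriviallyNormedField 𝕜]
  {E : Type*} [NormedAddCommGroup E] [NormedSpace 𝕜 E] {H : Type*} [TopologicalSpace H]
  {I : ModelWithCorners 𝕜 E H} {M : Type*} [TopologicalSpace M] [ChartedSpace H M]
  {E' : Type*} [NormedAddCommGroup E'] [NormedSpace 𝕜 E'] {H' : Type*} [TopologicalSpace H']
  {I' : ModelWithCorners 𝕜 E' H'} {M' : Type*} [TopologicalSpace M'] [ChartedSpace H' M']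
  {E'' : Type*} [NormedAddCommGroup E''] [NormedSpace 𝕜 E''] {H'' : Type*} [TopologicalSpace H'']
  {I'' : ModelWithCorners 𝕜 E'' H''} {M'' : Type*} [TopologicalSpace M''] [ChartedSpace H'' M'']

theorem hasMFDerivAt_comp_of_eq {g : M' → M''} {f : M → M'} {x : M} {y : M'} {g' : E' →L[𝕜] E''}
    {f' : E →L[𝕜] E'} (hg : HasMFDerivAt I' I'' g y g') (hf : HasMFDerivAt I I' f x f')
    (hy : f x = y) : HasMFDerivAt I I'' (g ∘ f) x (g'.comp f') := by
  subst hy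
  exact hg.comp x hf

theorem isInvertible_mfderiv_of_equiv {n : ℕ∞ω} (e : M ≃ M') (he : ContMDiff I I' n e)
    (he' : ContMDiff I' I n e.symm) (hn : n ≠ 0) (x : M) : (mfderiv I I' e x).IsInvertible := by
  let Φ : M ≃ₘ^n⟮I, I'⟯ M' := ⟨e, he, he'⟩
  exact ⟨Φ.mfderivToContinuousLinearEquiv hn x, Φ.mfderivToContinuousLinearEquiv_coe hn⟩

end Derivatives

section Bracket

variable {𝕜 : Type*} [NontriviallyNormedField 𝕜] {E : Type*} [NormedAddCommGroup E]
  [NormedSpace 𝕜 E] {H : Type*} [TopologicalSpace H] {I : ModelWithCorners 𝕜 E H}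
  {M : Type*} [TopologicalSpace M] [ChartedSpace H M] {F : Type*} [NormedAddCommGroup F]
  [NormedSpace 𝕜 F]

theorem mpullbackWithin_extChartAt_symm_self [IsManifold I 1 M] (V : Π x : M, TangentSpace I x)
    (x : M) :
    (mpullbackWithin 𝓘(𝕜, E) I (extChartAt I x).symm V (range I) (extChartAt I x x) : E) =
      (V x : E) := by
  rw [mpullbackWithin_apply, extChartAt_to_inv]
  exact mfderivWithin_extChartAt_symm_inverse_apply (V x)

theorem mlieBracket_eq_zero_of_eventually_eq_zero_comp [IsManifold I 2 M] [CompleteSpace E]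
    {V W : Π x : M, TangentSpace I x} {γ : F → M} {t v : F}
    (hγ : MDifferentiableAt 𝓘(𝕜, F) I γ t) (hV : V (γ t) = mfderiv 𝓘(𝕜, F) I γ t v)
    (hW : MDiffAt (T% W) (γ t)) (hWγ : ∀ᶠ s in 𝓝 t, W (γ s) = 0) :
    mlieBracket I V W (γ t) = 0 := by
  have : IsManifold I 1 M := .of_le one_le_two
  set φ := extChartAt I (γ t)
  set V' : E → E := mpullbackWithin 𝓘(𝕜, E) I φ.symm V (range I)
  set W' : E → E := mpullbackWithin 𝓘(𝕜, E) I φ.symm W (range I)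
  have hφγ : HasFDerivAt (φ ∘ γ) (mfderiv 𝓘(𝕜, F) I γ t : F →L[𝕜] E) t :=
    hγ.hasMFDerivAt.2.hasFDerivAt (by simp)
  have hV' : V' (φ (γ t)) = V (γ t) := mpullbackWithin_extChartAt_symm_self V (γ t)
  have hW' : DifferentiableWithinAt 𝕜 W' (range I) (φ (γ t)) := by
    have := (mdifferentiableWithinAt_univ.2 hW).differentiableWithinAt_mpullbackWithin_vectorField
    rwa [preimage_univ, univ_inter] at this
  have hW'γ : W' ∘ φ ∘ γ =ᶠ[𝓝 t] 0 := by
    have hγφ := hγ.continuousAt.preimage_mem_nhds (extChartAt_source_mem_nhds (I := I) (γ t))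
    filter_upwards [hWγ, hγφ] with s hs hsφ
    have hW0 : W (φ.symm (φ (γ s))) = 0 := by rwa [φ.left_inv hsφ]
    exact (congrArg (mfderivWithin 𝓘(𝕜, E) I φ.symm (range I) (φ (γ s))).inverse hW0).trans
      (map_zero _)
  have hcomp : HasFDerivAt (W' ∘ φ ∘ γ) _ t :=
    hW'.hasFDerivWithinAt.comp_hasFDerivAt t hφγ
      (Eventually.of_forall fun s => mem_range_self (chartAt H (γ t) (γ s)))
  have hbracket : lieBracketWithin 𝕜 V' W' (range I) (φ (γ t)) = 0 := by
    have hderiv := hcomp.unique ((hasFDerivAt_const (0 : E) t).congr_of_eventuallyEq hW'γ)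
    have hzero : W' (φ (γ t)) = 0 := hW'γ.self_of_nhds
    simp only [lieBracketWithin]
    rw [hzero, map_zero, sub_zero, hV', hV]
    exact congrArg (fun L => L v) hderiv
  rw [← mlieBracketWithin_univ, mlieBracketWithin_apply, preimage_univ, univ_inter]
  exact (congrArg _ hbracket).trans (map_zero _)

end Bracket

section GroupLieAlgebra

variable {𝕜 : Type*} [NontriviallyNormedField 𝕜] {E : Type*} [NormedAddCommGroup E]
  [NormedSpace 𝕜 E] {H : Type*} [TopologicalSpace H] {I : ModelWithCorners 𝕜 E H}
  {G : Type*} [TopologicalSpace G] [ChartedSpace H G] [Group G]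
  {E' : Type*} [NormedAddCommGroup E'] [NormedSpace 𝕜 E'] {H' : Type*} [TopologicalSpace H']
  {J : ModelWithCorners 𝕜 E' H'}
  {G' : Type*} [TopologicalSpace G'] [ChartedSpace H' G'] [Group G']

theorem minSmoothness_three_ne_zero : minSmoothness 𝕜 3 ≠ 0 :=
  (lt_of_lt_of_le (by simp) le_minSmoothness).ne'

variable (I J) in
/-- The linear map between the Lie algebras of two Lie groups induced by a group homomorphism, that
is, its derivative at `1`. -/
def groupLieAlgebraMap (φ : G →* G') : GroupLieAlgebra I G →L[𝕜] GroupLieAlgebra J G' :=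
  (mfderiv I J φ 1 : E →L[𝕜] E')

theorem mulInvariantVectorField_one (X : GroupLieAlgebra I G) :
    mulInvariantVectorField X 1 = X := by
  have hone_mul : (fun x : G => 1 * x) = id := funext one_mul
  rw [mulInvariantVectorField, hone_mul, mfderiv_id]
  rfl

theorem contMDiff_conj {n : ℕ∞ω} [LieGroup I n G] (g : G) : ContMDiff I I n (MulAut.conj g) :=
  (contMDiff_mul_right (a := g⁻¹)).comp (contMDiff_mul_left (a := g))

variable [LieGroup I (minSmoothness 𝕜 3) G] [LieGroup J (minSmoothness 𝕜 3) G'] {φ : G →* G'}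

theorem hasMFDerivAt_mul_left (g x : G) :
    HasMFDerivAt I I (g * ·) x (mfderiv I I (g * ·) x) :=
  ((contMDiff_mul_left (I := I) (n := minSmoothness 𝕜 3)).contMDiffAt.mdifferentiableAt
    minSmoothness_three_ne_zero).hasMFDerivAt

theorem hasMFDerivAt_mul_right (g x : G) :
    HasMFDerivAt I I (· * g) x (mfderiv I I (· * g) x) :=
  ((contMDiff_mul_right (I := I) (n := minSmoothness 𝕜 3)).contMDiffAt.mdifferentiableAt
    minSmoothness_three_ne_zero).hasMFDerivAt

theorem mfderiv_mulInvariantVectorField (hφ : MDifferentiable I J φ) (X : GroupLieAlgebra I G)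
    (g : G) : mfderiv I J φ g (mulInvariantVectorField X g) =
      mulInvariantVectorField (groupLieAlgebraMap I J φ X) (φ g) := by
  have hl : HasMFDerivAt I J (fun x => φ (g * x)) 1 _ :=
    hasMFDerivAt_comp_of_eq (hφ g).hasMFDerivAt (hasMFDerivAt_mul_left g 1) (mul_one g)
  have hr : HasMFDerivAt I J (fun x => φ g * φ x) 1 _ :=
    hasMFDerivAt_comp_of_eq (hasMFDerivAt_mul_left (φ g) 1) (hφ 1).hasMFDerivAt φ.map_one
  have hφg : (fun x => φ (g * x)) = fun x => φ g * φ x := funext (map_mul φ g)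
  rw [hφg] at hl
  exact congrArg (fun L : E →L[𝕜] E' => L X) (hasMFDerivAt_unique hl hr)

theorem mpullback_mulInvariantVectorField_groupLieAlgebraMap (hφ : MDifferentiable I J φ)
    (hφ' : ∀ g, (mfderiv I J φ g).IsInvertible) (X : GroupLieAlgebra I G) :
    mpullback I J φ (mulInvariantVectorField (groupLieAlgebraMap I J φ X)) =
      mulInvariantVectorField X := by
  ext g
  rw [mpullback_apply, ← mfderiv_mulInvariantVectorField hφ]
  exact (hφ' g).inverse_apply_self _

theorem groupLieAlgebraMap_lie [CompleteSpace E] [CompleteSpace E']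
    (hφ : ContMDiff I J (minSmoothness 𝕜 3) φ)
    (hφ' : ∀ g, (mfderiv I J φ g).IsInvertible) (X Y : GroupLieAlgebra I G) :
    groupLieAlgebraMap I J φ ⁅X, Y⁆ =
      ⁅groupLieAlgebraMap I J φ X, groupLieAlgebraMap I J φ Y⁆ := by
  have hd : MDifferentiable I J φ := hφ.mdifferentiable minSmoothness_three_ne_zero
  obtain ⟨Z, hZ⟩ : ∃ Z, groupLieAlgebraMap I J φ Z =
    ⁅groupLieAlgebraMap I J φ X, groupLieAlgebraMap I J φ Y⁆ := (hφ' 1).bijective.surjective _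
  have hpullback := congrFun (mpullback_mulInvariantVectorField_groupLieAlgebraMap hd hφ' Z) 1
  rw [hZ, GroupLieAlgebra.bracket_def, mulInvariantVector_mlieBracket,
    mpullback_mlieBracket (n := minSmoothness 𝕜 3) (mdifferentiableAt_mulInvariantVectorField _)
      (mdifferentiableAt_mulInvariantVectorField _) hφ.contMDiffAt
      (minSmoothness_monotone (by norm_num)),
    mpullback_mulInvariantVectorField_groupLieAlgebraMap hd hφ',
    mpullback_mulInvariantVectorField_groupLieAlgebraMap hd hφ',
    mulInvariantVectorField_one] at hpullback
  rw [← hZ, ← hpullback]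
  rfl

/-- The isomorphism of Lie algebras induced by an isomorphism of Lie groups. -/
def groupLieAlgebraEquiv [CompleteSpace E] [CompleteSpace E'] (e : G ≃* G')
    (he : ContMDiff I J (minSmoothness 𝕜 3) e) (he' : ContMDiff J I (minSmoothness 𝕜 3) e.symm) :
    GroupLieAlgebra I G ≃ₗ⁅𝕜⁆ GroupLieAlgebra J G' :=
  have he_inv := isInvertible_mfderiv_of_equiv e.toEquiv he he' minSmoothness_three_ne_zero
  LieEquiv.ofBijective
    { groupLieAlgebraMap I J e.toMonoidHom with
      map_lie' := fun {X Y} => groupLieAlgebraMap_lie (φ := e.toMonoidHom) he he_inv X Y }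
    (he_inv 1).bijective

variable (I) in
/-- The adjoint representation: the derivative at `1` of conjugation by `g`, as an automorphism of
the Lie algebra. -/
def adjointAction [CompleteSpace E] (g : G) : GroupLieAlgebra I G ≃ₗ⁅𝕜⁆ GroupLieAlgebra I G :=
  groupLieAlgebraEquiv (MulAut.conj g) (contMDiff_conj g) <| by
    rw [← MulAut.inv_def, ← map_inv]
    exact contMDiff_conj _

end GroupLieAlgebra

section Velocity

variable {𝕜 : Type*} [NontriviallyNormedField 𝕜] {E : Type*} [NormedAddCommGroup E]
  [NormedSpace 𝕜 E] {H : Type*} [TopologicalSpace H] {I : ModelWithCorners 𝕜 E H}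
  {G : Type*} [TopologicalSpace G] [ChartedSpace H G] [Group G]
  {F : Type*} [NormedAddCommGroup F] [NormedSpace 𝕜 F] {f : AddChar F G}

variable (I) in
/-- The derivative at `0` of a homomorphism from a vector space to a Lie group. -/
def velocity (f : AddChar F G) : F →L[𝕜] GroupLieAlgebra I G :=
  (mfderiv 𝓘(𝕜, F) I f 0 : F →L[𝕜] E)

variable [LieGroup I (minSmoothness 𝕜 3) G]

theorem mfderiv_eq_mulInvariantVectorField_velocity (hf : MDifferentiable 𝓘(𝕜, F) I f) (t x : F) :
    mfderiv 𝓘(𝕜, F) I f t x = mulInvariantVectorField (velocity I f x) (f t) := by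
  have htranslate : HasMFDerivAt 𝓘(𝕜, F) 𝓘(𝕜, F) (t + ·) 0 (ContinuousLinearMap.id 𝕜 F) :=
    ((hasFDerivAt_id (0 : F)).const_add t).hasMFDerivAt
  have hl : HasMFDerivAt 𝓘(𝕜, F) I (fun s => f (t + s)) 0 _ :=
    hasMFDerivAt_comp_of_eq (hf t).hasMFDerivAt htranslate (add_zero t)
  have hr : HasMFDerivAt 𝓘(𝕜, F) I (fun s => f t * f s) 0 _ :=
    hasMFDerivAt_comp_of_eq (hasMFDerivAt_mul_left (f t) 1) (hf 0).hasMFDerivAt f.map_zero_eq_one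
  have hft : (fun s => f (t + s)) = fun s => f t * f s := funext (f.map_add_eq_mul t)
  rw [hft] at hl
  exact congrArg (fun L : F →L[𝕜] E => L x) (hasMFDerivAt_unique hl hr)

theorem mdifferentiable_inv : MDifferentiable I I (fun g : G => g⁻¹) :=
  (contMDiff_inv I (minSmoothness 𝕜 3)).mdifferentiable minSmoothness_three_ne_zero

theorem mfderiv_inv_mulInvariantVectorField (g : G) (X : GroupLieAlgebra I G) :
    (mfderiv I I (fun g : G => g⁻¹) g (mulInvariantVectorField X g) : E) =
      -(mfderiv I I (fun x => x * g⁻¹) 1 X : E) := by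
  let q : G × G → G := fun p => p.1⁻¹ * (p.2 * g⁻¹)
  have hq : ContMDiff (I.prod I) I (minSmoothness 𝕜 3) q :=
    contMDiff_fst.inv.mul (contMDiff_snd.mul contMDiff_const)
  have hqd : MDifferentiableAt (I.prod I) I q (1, 1) :=
    hq.contMDiffAt.mdifferentiableAt minSmoothness_three_ne_zero
  have hdiag : HasMFDerivAt I (I.prod I) (fun x : G => (x, x)) 1 _ :=
    (hasMFDerivAt_id 1).prodMk (hasMFDerivAt_id 1)
  have hconst : q ∘ (fun x : G => (x, x)) = fun _ => g⁻¹ := by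
    funext x
    simp [q]
  have hzero := hasMFDerivAt_comp_of_eq hqd.hasMFDerivAt hdiag rfl
  rw [hconst] at hzero
  have hfst : (fun x => q (x, 1)) = (fun y : G => y⁻¹) ∘ (g * ·) := by
    funext x
    simp [q]
  have hsnd : (fun x => q (1, x)) = fun x => x * g⁻¹ := by
    funext x
    simp [q]
  have hsum : (mfderiv (I.prod I) I q (1, 1) ((X : E), (X : E)) : E) =
      mfderiv I I (fun x => q (x, 1)) 1 X + mfderiv I I (fun x => q (1, x)) 1 X :=
    mfderiv_prod_eq_add_apply hqd
  have hinv := hasMFDerivAt_comp_of_eq (mdifferentiable_inv g).hasMFDerivAt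
    (hasMFDerivAt_mul_left (I := I) g 1) (mul_one g)
  rw [hfst, hsnd, hinv.mfderiv] at hsum
  have h0 := congrArg (fun L : E →L[𝕜] E => L X) (hasMFDerivAt_unique hzero
    (hasMFDerivAt_const g⁻¹ (1 : G)))
  exact eq_neg_of_add_eq_zero_left (hsum.symm.trans h0)

theorem isInvertible_mfderiv_inv (g : G) : (mfderiv I I (fun g : G => g⁻¹) g).IsInvertible :=
  isInvertible_mfderiv_of_equiv (Equiv.inv G) (contMDiff_inv I _) (contMDiff_inv I _)
    (minSmoothness_three_ne_zero (𝕜 := 𝕜)) g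

theorem mpullback_inv_mulInvariantVectorField_apply {g : G} {X : GroupLieAlgebra I G}
    (h : (mfderiv I I (fun x => x * g⁻¹) 1 X : E) = mulInvariantVectorField X g⁻¹) :
    mpullback I I (fun g : G => g⁻¹) (mulInvariantVectorField (-X)) g =
      mulInvariantVectorField X g := by
  have hneg : (mulInvariantVectorField (-X) g⁻¹ : E) =
      mfderiv I I (fun g : G => g⁻¹) g (mulInvariantVectorField X g) := by
    rw [mfderiv_inv_mulInvariantVectorField, h]
    exact map_neg (mfderiv I I (g⁻¹ * ·) 1) X
  rw [mpullback_apply]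
  exact (congrArg _ hneg).trans ((isInvertible_mfderiv_inv g).inverse_apply_self _)

theorem mpullback_inv_mulInvariantVectorField_apply_of_mem_center {g : G}
    (hg : g ∈ Subgroup.center G) (X : GroupLieAlgebra I G) :
    mpullback I I (fun g : G => g⁻¹) (mulInvariantVectorField (-X)) g =
      mulInvariantVectorField X g := by
  refine mpullback_inv_mulInvariantVectorField_apply ?_
  have hcomm : (fun x => x * g⁻¹) = (g⁻¹ * ·) :=
    funext fun x => Subgroup.mem_center_iff.1 (inv_mem hg) x
  rw [hcomm]
  rfl

theorem mpullback_inv_mulInvariantVectorField_velocity (hf : MDifferentiable 𝓘(𝕜, F) I f)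
    (hcenter : ∀ t, f t ∈ Subgroup.center G) (x : F) :
    mpullback I I (fun g : G => g⁻¹) (mulInvariantVectorField (-velocity I f x)) =
      mulInvariantVectorField (velocity I f x) := by
  funext g
  refine mpullback_inv_mulInvariantVectorField_apply ?_
  have hr : HasMFDerivAt 𝓘(𝕜, F) I (fun t => f t * g⁻¹) 0 _ :=
    hasMFDerivAt_comp_of_eq (hasMFDerivAt_mul_right g⁻¹ 1) (hf 0).hasMFDerivAt f.map_zero_eq_one
  have hl : HasMFDerivAt 𝓘(𝕜, F) I (fun t => g⁻¹ * f t) 0 _ :=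
    hasMFDerivAt_comp_of_eq (hasMFDerivAt_mul_left g⁻¹ 1) (hf 0).hasMFDerivAt f.map_zero_eq_one
  have hcomm : (fun t => f t * g⁻¹) = fun t => g⁻¹ * f t :=
    funext fun t => (Subgroup.mem_center_iff.1 (hcenter t) g⁻¹).symm
  rw [hcomm] at hr
  exact congrArg (fun L : F →L[𝕜] E => L x) (hasMFDerivAt_unique hr hl)

variable [CompleteSpace E]

theorem mlieBracket_mpullback_inv_one (hf : MDifferentiable 𝓘(𝕜, F) I f)
    (hcenter : ∀ t, f t ∈ Subgroup.center G) (x : F) (Y : GroupLieAlgebra I G) :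
    mlieBracket I (mulInvariantVectorField (velocity I f x))
      (mpullback I I (fun g : G => g⁻¹) (mulInvariantVectorField Y)) 1 = ⁅velocity I f x, Y⁆ := by
  rw [← mpullback_inv_mulInvariantVectorField_velocity hf hcenter,
    ← mpullback_mlieBracket (n := minSmoothness 𝕜 3) (mdifferentiableAt_mulInvariantVectorField _)
      (mdifferentiableAt_mulInvariantVectorField _)
      (contMDiff_inv I (minSmoothness 𝕜 3)).contMDiffAt (minSmoothness_monotone (by norm_num)),
    ← mulInvariantVector_mlieBracket, ← GroupLieAlgebra.bracket_def, neg_lie,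
    mpullback_inv_mulInvariantVectorField_apply_of_mem_center (one_mem _),
    mulInvariantVectorField_one]

theorem lie_velocity_eq_zero [NeZero (2 : 𝕜)] (hf : MDifferentiable 𝓘(𝕜, F) I f)
    (hcenter : ∀ t, f t ∈ Subgroup.center G) (x : F) (Y : GroupLieAlgebra I G) :
    ⁅velocity I f x, Y⁆ = 0 := by
  have hsmooth : 2 ≤ minSmoothness 𝕜 3 := (by norm_num : (2 : ℕ∞ω) ≤ 3).trans le_minSmoothness
  have : IsManifold I 2 G := .of_le hsmooth
  -- Inversion carries `V` to `-V` and `W` to `Winv`, so `[V, Winv] = [V, W]` at `1`. But `W + Winv`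
  -- vanishes on the central subgroup `f(F)`, to which `V` is tangent, so `[V, W + Winv] = 0` there.
  let V : Π g : G, TangentSpace I g := mulInvariantVectorField (velocity I f x)
  let W : Π g : G, TangentSpace I g := mulInvariantVectorField Y
  let Winv : Π g : G, TangentSpace I g := mpullback I I (fun g => g⁻¹) (mulInvariantVectorField Y)
  have hWinv (g : G) : MDiffAt (T% Winv) g :=
    (mdifferentiableAt_mulInvariantVectorField Y).mpullback_vectorField
      (contMDiff_inv I (minSmoothness 𝕜 3)).contMDiffAt (isInvertible_mfderiv_inv g) hsmooth
  have hvanish (t : F) : (W + Winv) (f t) = 0 := by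
    have hneg := mpullback_inv_mulInvariantVectorField_apply_of_mem_center (I := I) (hcenter t) (-Y)
    rw [neg_neg] at hneg
    rw [Pi.add_apply, show Winv (f t) = mulInvariantVectorField (-Y) (f t) from hneg,
      ← Pi.add_apply, ← mulInvariantVectorField_add, add_neg_cancel]
    exact map_zero (mfderiv I I (f t * ·) 1)
  have hbracket : mlieBracket I V (W + Winv) 1 = 0 := by
    rw [← f.map_zero_eq_one]
    exact mlieBracket_eq_zero_of_eventually_eq_zero_comp (hf 0)
      (mfderiv_eq_mulInvariantVectorField_velocity hf 0 x).symm
      (mdifferentiableAt_add_section (mdifferentiableAt_mulInvariantVectorField Y) (hWinv _))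
      (.of_forall hvanish)
  rw [mlieBracket_add_right (mdifferentiableAt_mulInvariantVectorField _) (hWinv 1),
    mlieBracket_mpullback_inv_one hf hcenter] at hbracket
  have htwo : (2 : 𝕜) • ⁅velocity I f x, Y⁆ = 0 := (two_smul 𝕜 _).trans hbracket
  exact (smul_eq_zero_iff_right two_ne_zero).1 htwo

theorem velocity_mem_center [NeZero (2 : 𝕜)] (hf : MDifferentiable 𝓘(𝕜, F) I f)
    (hcenter : ∀ t, f t ∈ Subgroup.center G) (x : F) :
    velocity I f x ∈ LieAlgebra.center 𝕜 (GroupLieAlgebra I G) := by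
  rw [LieModule.mem_maxTrivSubmodule]
  intro Y
  rw [← lie_skew, lie_velocity_eq_zero hf hcenter, neg_zero]

end Velocity

section IntegralCurves

variable {E : Type*} [NormedAddCommGroup E] [NormedSpace ℝ E] {H : Type*} [TopologicalSpace H]
  {I : ModelWithCorners ℝ E H}
  {G : Type*} [TopologicalSpace G] [ChartedSpace H G] [Group G]
  {E' : Type*} [NormedAddCommGroup E'] [NormedSpace ℝ E'] {H' : Type*} [TopologicalSpace H']
  {I' : ModelWithCorners ℝ E' H'}
  {G' : Type*} [TopologicalSpace G'] [ChartedSpace H' G'] [Group G']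
  {F F' : Type*} [NormedAddCommGroup F] [NormedSpace ℝ F] [NormedAddCommGroup F'] [NormedSpace ℝ F']
  {f : AddChar F G} {f' : AddChar F' G}

variable (I G) in
theorem t2Space_of_lieGroup {n : ℕ∞ω} [LieGroup I n G] : T2Space G := by
  have := topologicalGroup_of_lieGroup (G := G) I n
  have := I.t1Space G
  infer_instance

variable [LieGroup I (minSmoothness ℝ 3) G] [LieGroup I' (minSmoothness ℝ 3) G']

theorem isMIntegralCurve_mulInvariantVectorField_unique [BoundarylessManifold I G]
    {X : GroupLieAlgebra I G} {γ γ' : ℝ → G}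
    (hγ : IsMIntegralCurve γ (mulInvariantVectorField (I := I) X))
    (hγ' : IsMIntegralCurve γ' (mulInvariantVectorField (I := I) X)) (h : γ 0 = γ' 0) :
    γ = γ' := by
  have := t2Space_of_lieGroup I G (n := minSmoothness ℝ 3)
  have : IsManifold I 1 G :=
    .of_le (n := minSmoothness ℝ 3) ((by norm_num : (1 : ℕ∞ω) ≤ 3).trans le_minSmoothness)
  refine isMIntegralCurve_Ioo_eq_of_contMDiff_boundaryless (t₀ := 0) ?_ hγ hγ' h
  exact (contMDiff_mulInvariantVectorField X).of_le
    ((by norm_num : (1 : ℕ∞ω) ≤ 2).trans le_minSmoothness)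

theorem isMIntegralCurve_monoidHom_comp {φ : G →* G'} (hφ : MDifferentiable I I' φ)
    {X : GroupLieAlgebra I G} {γ : ℝ → G}
    (hγ : IsMIntegralCurve γ (mulInvariantVectorField (I := I) X)) :
    IsMIntegralCurve (φ ∘ γ) (mulInvariantVectorField (I := I') (groupLieAlgebraMap I I' φ X)) := by
  intro t
  refine ((hφ (γ t)).hasMFDerivAt.comp t (hγ t)).congr_mfderiv ?_
  rw [Function.comp_apply, ← mfderiv_mulInvariantVectorField hφ]
  exact ContinuousLinearMap.ext fun s : ℝ => map_smul (mfderiv I I' φ (γ t) : E →L[ℝ] E') s _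

theorem isMIntegralCurve_addChar (hf : MDifferentiable 𝓘(ℝ, F) I f) (x : F) :
    IsMIntegralCurve (fun t : ℝ => f (t • x))
      (mulInvariantVectorField (I := I) (velocity I f x)) := by
  intro t
  have hline : HasMFDerivAt 𝓘(ℝ, ℝ) 𝓘(ℝ, F) (fun s : ℝ => s • x) t
      ((1 : ℝ →L[ℝ] ℝ).smulRight x) :=
    ((1 : ℝ →L[ℝ] ℝ).hasFDerivAt.smul_const x).hasMFDerivAt
  refine ((hf (t • x)).hasMFDerivAt.comp t hline).congr_mfderiv ?_
  rw [← mfderiv_eq_mulInvariantVectorField_velocity hf]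
  exact ContinuousLinearMap.ext fun s : ℝ =>
    map_smul (mfderiv 𝓘(ℝ, F) I f (t • x) : F →L[ℝ] E) s x

theorem eq_of_velocity_eq [BoundarylessManifold I G] (hf : MDifferentiable 𝓘(ℝ, F) I f)
    (hf' : MDifferentiable 𝓘(ℝ, F') I f') {x : F} {y : F'}
    (h : velocity I f x = velocity I f' y) : f x = f' y := by
  have hy := isMIntegralCurve_addChar hf' y
  rw [← h] at hy
  simpa using congrFun (isMIntegralCurve_mulInvariantVectorField_unique
    (isMIntegralCurve_addChar hf x) hy (by simp)) 1

end IntegralCurves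

section Exponential

variable {d : ℕ} {G : Type*} [TopologicalSpace G] [ChartedSpace (EuclideanSpace ℝ (Fin d)) G]
  [Group G] [LieGroup (𝓡 d) ∞ G] {F : Type*} [NormedAddCommGroup F] [NormedSpace ℝ F]

theorem isExp_velocity {f : AddChar F G} (hf : MDifferentiable 𝓘(ℝ, F) (𝓡 d) f) (x : F) :
    IsExp (velocity (𝓡 d) f x) (f x) :=
  ⟨_, isMIntegralCurve_addChar hf x, by simp, by simp⟩

theorem IsExp.conj {X : GroupLieAlgebra (𝓡 d) G} {h : G} (hX : IsExp X h) (g : G) :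
    IsExp (adjointAction (𝓡 d) g X) (g * h * g⁻¹) := by
  obtain ⟨γ, hγ, h0, h1⟩ := hX
  refine ⟨_, isMIntegralCurve_monoidHom_comp (φ := (MulAut.conj g).toMonoidHom) ?_ hγ, ?_, ?_⟩
  · exact (contMDiff_conj (n := minSmoothness ℝ 3) g).mdifferentiable minSmoothness_three_ne_zero
  · simp [h0]
  · simp [h1]

theorem integralSubgroup_normal {𝔥 : Set (GroupLieAlgebra (𝓡 d) G)}
    (h𝔥 : ∀ g, ∀ X ∈ 𝔥, adjointAction (𝓡 d) g X ∈ 𝔥) :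
    (integralSubgroup 𝔥).Normal := by
  refine ⟨fun h hh g => ?_⟩
  suffices h_le : integralSubgroup 𝔥 ≤
      (integralSubgroup 𝔥).comap (MulAut.conj g).toMonoidHom from h_le hh
  refine (Subgroup.closure_le _).2 ?_
  rintro x ⟨X, hX, hx⟩
  exact Subgroup.subset_closure ⟨_, h𝔥 g X hX, hx.conj g⟩

end Exponential

section Ideals

variable {R L L' : Type*} [CommRing R] [LieRing L'] [LieAlgebra R L'] [LieRing L] [LieAlgebra R L]

/-- The restriction of a homomorphism of Lie algebras to the preimage of an ideal. -/
def comapRestrict (f : L →ₗ⁅R⁆ L') (J : LieIdeal R L') : J.comap f →ₗ⁅R⁆ J where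
  toFun x := ⟨f x, LieIdeal.mem_comap.1 x.2⟩
  map_add' x y := Subtype.ext (map_add f x.1 y.1)
  map_smul' c x := Subtype.ext (map_smul f c x.1)
  map_lie' {x y} := Subtype.ext (f.map_lie x y)

theorem comapRestrict_injective {f : L →ₗ⁅R⁆ L'} (hf : Function.Injective f)
    (J : LieIdeal R L') : Function.Injective (comapRestrict f J) :=
  fun _ _ h => Subtype.ext (hf (congrArg Subtype.val h))

theorem lieEquiv_apply_mem_sSup {S : Set (LieIdeal R L)} {S' : Set (LieIdeal R L')}
    (e : L ≃ₗ⁅R⁆ L') (hS : ∀ J ∈ S, J.comap e.symm.toLieHom ∈ S') {x : L} (hx : x ∈ sSup S) :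
    e x ∈ sSup S' := by
  suffices h_le : sSup S ≤ (sSup S').comap e.toLieHom from LieIdeal.mem_comap.1 (h_le hx)
  refine sSup_le fun J hJ y hy => LieIdeal.mem_comap.2 (le_sSup (hS J hJ) (LieIdeal.mem_comap.2 ?_))
  exact (e.symm_apply_apply y).symm ▸ hy

theorem lieEquiv_apply_mem_radical (e : L ≃ₗ⁅R⁆ L') {x : L} (hx : x ∈ LieAlgebra.radical R L) :
    e x ∈ LieAlgebra.radical R L' := by
  refine lieEquiv_apply_mem_sSup e (fun J hJ => ?_) hx
  have : LieAlgebra.IsSolvable J := hJ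
  exact (comapRestrict_injective e.symm.injective J).lieAlgebra_isSolvable

end Ideals

section Nilradical

variable {L L' : Type*} [LieRing L] [LieAlgebra ℝ L] [LieRing L'] [LieAlgebra ℝ L']

theorem lieEquiv_apply_mem_nilradical (e : L ≃ₗ⁅ℝ⁆ L') {x : L} (hx : x ∈ nilradical L) :
    e x ∈ nilradical L' := by
  refine lieEquiv_apply_mem_sSup e (fun J hJ => ?_) hx
  have : LieRing.IsNilpotent J := hJ
  exact (comapRestrict_injective e.symm.injective J).lieAlgebra_isNilpotent

variable (L)

theorem center_le_nilradical : LieAlgebra.center ℝ L ≤ nilradical L :=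
  le_sSup (inferInstanceAs (LieRing.IsNilpotent (LieAlgebra.center ℝ L)))

theorem nilradical_le_radical : nilradical L ≤ LieAlgebra.radical ℝ L := by
  refine sSup_le fun J hJ => le_sSup ?_
  have : LieRing.IsNilpotent J := hJ
  exact inferInstanceAs (LieAlgebra.IsSolvable J)

end Nilradical

section Center

variable {G : Type*} [Group G]

theorem mem_centerOf {H : Subgroup G} {g : G} :
    g ∈ centerOf H ↔ g ∈ H ∧ ∀ h ∈ H, h * g = g * h := by
  simp only [centerOf, Subgroup.mem_map, Subgroup.mem_center_iff, Subgroup.coe_subtype]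
  constructor
  · rintro ⟨x, hx, rfl⟩
    exact ⟨x.2, fun h hh => congrArg Subtype.val (hx ⟨h, hh⟩)⟩
  · rintro ⟨hg, h⟩
    exact ⟨⟨g, hg⟩, fun x => Subtype.ext (h x x.2), rfl⟩

theorem centerOf_top : centerOf (⊤ : Subgroup G) = Subgroup.center G := by
  ext g
  simp [mem_centerOf, Subgroup.mem_center_iff]

theorem centerOf_normal (H : Subgroup G) [H.Normal] : (centerOf H).Normal :=
  ConjAct.normal_of_characteristic_of_normal

theorem centerOf_commute {H : Subgroup G} {x y : G} (hx : x ∈ centerOf H) (hy : y ∈ centerOf H) :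
    Commute x y :=
  (mem_centerOf.1 hy).2 x (mem_centerOf.1 hx).1

variable [TopologicalSpace G] [IsTopologicalGroup G] [T2Space G] [PreconnectedSpace G]

theorem mem_center_of_finite_conj_mem {s : Set G} (hs : s.Finite) {k : G}
    (hk : ∀ g, g * k * g⁻¹ ∈ s) : k ∈ Subgroup.center G := by
  rw [Subgroup.mem_center_iff]
  intro g
  have hconst : g * k * g⁻¹ = 1 * k * 1⁻¹ :=
    isPreconnected_univ.constant_of_mapsTo (f := fun g => g * k * g⁻¹) hs.isDiscrete (by fun_prop)
      (fun g _ => hk g) (mem_univ g) (mem_univ 1)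
  simpa [mul_inv_eq_iff_eq_mul] using hconst

theorem le_center_of_finite_torsion_of_dense_torsion {K : Subgroup G} [hK : K.Normal]
    (hfinite : ∀ m > 0, {g ∈ K | g ^ m = 1}.Finite)
    (hdense : (K : Set G) ⊆ closure {g ∈ K | ∃ m > 0, g ^ m = 1}) : K ≤ Subgroup.center G := by
  have hclosed : IsClosed (Subgroup.center G : Set G) := by
    rw [Subgroup.coe_center, ← Set.centralizer_univ]
    exact Set.isClosed_centralizer _
  refine hdense.trans (closure_minimal ?_ hclosed)
  rintro t ⟨ht, m, hm, htm⟩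
  exact mem_center_of_finite_conj_mem (hfinite m hm)
    fun g => ⟨hK.conj_mem t ht g, by rw [conj_pow, htm, mul_one, mul_inv_cancel]⟩

end Center

section Radicals

variable {d : ℕ} {G : Type*} [TopologicalSpace G] [ChartedSpace (EuclideanSpace ℝ (Fin d)) G]
  [Group G] [LieGroup (𝓡 d) ∞ G] {F : Type*} [NormedAddCommGroup F] [NormedSpace ℝ F]

instance nilpotentRadical_normal : (nilpotentRadical d G).Normal :=
  integralSubgroup_normal fun _ _ hX => lieEquiv_apply_mem_nilradical _ hX

instance solvableRadical_normal : (solvableRadical d G).Normal :=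
  integralSubgroup_normal fun _ _ hX => lieEquiv_apply_mem_radical _ hX

theorem nilpotentRadical_le_solvableRadical : nilpotentRadical d G ≤ solvableRadical d G :=
  Subgroup.closure_mono fun _ ⟨X, hX, h⟩ => ⟨X, nilradical_le_radical _ hX, h⟩

theorem mem_nilpotentRadical_of_mem_center {f : AddChar F G}
    (hf : MDifferentiable 𝓘(ℝ, F) (𝓡 d) f) (hcenter : ∀ t, f t ∈ Subgroup.center G) (x : F) :
    f x ∈ nilpotentRadical d G :=
  Subgroup.subset_closure
    ⟨_, center_le_nilradical _ (velocity_mem_center hf hcenter x), isExp_velocity hf x⟩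

end Radicals

section KernelLattice

variable {G : Type*} [Group G]
  {F F' : Type*} [NormedAddCommGroup F] [NormedSpace ℝ F] [AddCommGroup F'] [Module ℝ F']
  {f : AddChar F G} {f' : AddChar F' G}

theorem exists_mem_ker_iff_repr_int [FiniteDimensional ℝ F] (f : AddChar F G)
    (hdisc : ∀ᶠ x in 𝓝[≠] (0 : F), f x ≠ 1) (hspan : Submodule.span ℝ {x | f x = 1} = ⊤) :
    ∃ (n : ℕ) (b : Module.Basis (Fin n) ℝ F), ∀ x, f x = 1 ↔ ∀ i, ∃ m : ℤ, b.repr x i = m := by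
  let Λ : Submodule ℤ F := (AddMonoidHom.ker f.toAddMonoidHom).toIntSubmodule
  have : DiscreteTopology Λ := by
    refine discreteTopology_iff_isOpen_singleton_zero.2
      ((isOpen_singleton_iff_nhds_eq_pure _).2 (le_antisymm (le_pure_iff.2 ?_) (pure_le_nhds _)))
    have hval : Tendsto (Subtype.val : Λ → F) (𝓝 0) (𝓝 0) := continuous_subtype_val.tendsto _
    filter_upwards [hval.eventually (eventually_nhdsWithin_iff.1 hdisc)] with x hx
    by_contra hne
    exact hx (fun h0 => hne (Subtype.ext h0)) x.2
  have : IsZLattice ℝ Λ := ⟨hspan⟩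
  have := ZLattice.module_finite ℝ Λ
  have := ZLattice.module_free ℝ Λ
  let b := (Module.Free.chooseBasis ℤ Λ).reindex (Fintype.equivFin _)
  let c := b.ofZLatticeBasis ℝ
  refine ⟨_, c, fun x => ?_⟩
  have hx : f x = 1 ↔ x ∈ Submodule.span ℤ (range c) := by
    rw [b.ofZLatticeBasis_span ℝ Λ]
    exact Iff.rfl
  rw [hx, c.mem_span_iff_repr_mem ℤ]
  simp [eq_comm]

theorem span_ker_eq_top_of_comp {p : F →ₗ[ℝ] F'} (hp : Function.Surjective p)
    (hcomp : ∀ x, f' (p x) = f x) (hf : Submodule.span ℝ {x | f x = 1} = ⊤) :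
    Submodule.span ℝ {x | f' x = 1} = ⊤ := by
  have hker : p '' {x | f x = 1} ⊆ {x | f' x = 1} := by
    rintro _ ⟨x, hx, rfl⟩
    exact (hcomp x).trans hx
  rw [eq_top_iff, ← LinearMap.range_eq_top.2 hp, LinearMap.range_eq_map, ← hf, Submodule.map_span]
  exact Submodule.span_mono hker

end KernelLattice

section VelocityOfHom

variable {E : Type*} [NormedAddCommGroup E] [NormedSpace ℝ E] {H : Type*} [TopologicalSpace H]
  {I : ModelWithCorners ℝ E H}
  {G : Type*} [TopologicalSpace G] [ChartedSpace H G] [Group G]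
  {F F' : Type*} [NormedAddCommGroup F] [NormedSpace ℝ F] [NormedAddCommGroup F'] [NormedSpace ℝ F']
  {f : AddChar F G} {f' : AddChar F' G}

theorem velocity_compAddMonoidHom (hf : MDifferentiable 𝓘(ℝ, F) I f) (L : F' →L[ℝ] F) :
    velocity I (f.compAddMonoidHom (L : F' →+ F)) = (velocity I f).comp L :=
  (hasMFDerivAt_comp_of_eq (hf 0).hasMFDerivAt L.hasFDerivAt.hasMFDerivAt L.map_zero).mfderiv

theorem eventually_ne_one_of_velocity_injective [FiniteDimensional ℝ F]
    (hf : MDifferentiableAt 𝓘(ℝ, F) I f 0) (h : Function.Injective (velocity I f)) :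
    ∀ᶠ x in 𝓝[≠] (0 : F), f x ≠ 1 := by
  have hderiv : HasFDerivAt (extChartAt I (f 0) ∘ f) (velocity I f : F →L[ℝ] E) 0 :=
    hf.hasMFDerivAt.2.hasFDerivAt (by simp)
  let L : F →L[ℝ] E := velocity I f
  obtain ⟨C, -, hC⟩ := L.exists_antilipschitzWith (LinearMap.ker_eq_bot.2 h)
  filter_upwards [hderiv.eventually_ne (c := extChartAt I (f 0) 1) ⟨C, hC⟩] with x hx hfx
  exact hx (congrArg (extChartAt I (f 0)) hfx)

/-- The product of two homomorphisms from vector spaces to a group with commuting values. -/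
def mulOfCommute {A B M : Type*} [AddMonoid A] [AddMonoid B] [Monoid M] (f : AddChar A M)
    (f' : AddChar B M) (h : ∀ x y, Commute (f x) (f' y)) : AddChar (A × B) M where
  toFun z := f z.1 * f' z.2
  map_zero_eq_one' := by simp
  map_add_eq_mul' x y := by
    simp only [Prod.fst_add, Prod.snd_add, AddChar.map_add_eq_mul]
    exact (h y.1 x.2).mul_mul_mul_comm _ _

theorem velocity_mulOfCommute {h : ∀ x y, Commute (f x) (f' y)}
    (hff' : MDifferentiable 𝓘(ℝ, F × F') I (mulOfCommute f f' h)) :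
    velocity I (mulOfCommute f f' h) = (velocity I f).coprod (velocity I f') := by
  have hinl : (mulOfCommute f f' h).compAddMonoidHom
      (ContinuousLinearMap.inl ℝ F F' : F →+ F × F') = f := by
    ext x
    simp [mulOfCommute]
  have hinr : (mulOfCommute f f' h).compAddMonoidHom
      (ContinuousLinearMap.inr ℝ F F' : F' →+ F × F') = f' := by
    ext x
    simp [mulOfCommute]
  rw [← ContinuousLinearMap.coprod_comp_inl_inr (velocity I (mulOfCommute f f' h)),
    ← velocity_compAddMonoidHom hff', ← velocity_compAddMonoidHom hff', hinl, hinr]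

end VelocityOfHom

section Tori

variable {d : ℕ} {G : Type*} [TopologicalSpace G] [ChartedSpace (EuclideanSpace ℝ (Fin d)) G]
  [Group G]
  {F F' : Type*} [NormedAddCommGroup F] [NormedSpace ℝ F] [NormedAddCommGroup F'] [NormedSpace ℝ F']
  {f : AddChar F G} {f' : AddChar F' G}

variable (d) in
/-- A smooth homomorphism from a vector space to a Lie group whose kernel spans the vector space;
its image is a torus, but its kernel need not be discrete. -/
structure IsTorusCover (f : AddChar F G) : Prop where
  contMDiff : ContMDiff 𝓘(ℝ, F) (𝓡 d) ∞ f
  span_ker : Submodule.span ℝ {x | f x = 1} = ⊤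

theorem IsTorusCover.mdifferentiable (hf : IsTorusCover d f) :
    MDifferentiable 𝓘(ℝ, F) (𝓡 d) f :=
  hf.contMDiff.mdifferentiable (by simp)

theorem IsTorus.exists_addChar {K : Subgroup G} (hK : IsTorus d K) :
    ∃ (n : ℕ) (f : AddChar (Fin n → ℝ) G), ContMDiff 𝓘(ℝ, Fin n → ℝ) (𝓡 d) ∞ f ∧
      (∀ x, f x = 1 ↔ ∀ i, ∃ m : ℤ, x i = m) ∧ f.toMonoidHom.range = K := by
  obtain ⟨n, f, hsmooth, hadd, hker, hrange⟩ := hK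
  have hzero : f 0 = 1 := (hker 0).2 fun _ => ⟨0, by simp⟩
  exact ⟨n, ⟨f, hzero, hadd⟩, hsmooth, hker, SetLike.coe_injective hrange⟩

theorem IsTorus.exists_isTorusCover {K : Subgroup G} (hK : IsTorus d K) :
    ∃ (n : ℕ) (f : AddChar (Fin n → ℝ) G), IsTorusCover d f ∧ f.toMonoidHom.range = K := by
  obtain ⟨n, f, hsmooth, hker, hrange⟩ := hK.exists_addChar
  refine ⟨n, f, ⟨hsmooth, ?_⟩, hrange⟩
  rw [eq_top_iff, ← (Pi.basisFun ℝ (Fin n)).span_eq]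
  refine Submodule.span_mono ?_
  rintro _ ⟨i, rfl⟩
  refine (hker _).2 fun j => ⟨Pi.single (M := fun _ => ℤ) i 1 j, ?_⟩
  simp [Pi.single_apply]

theorem IsTorusCover.isTorus_range_of_velocity_injective [FiniteDimensional ℝ F]
    (hf : IsTorusCover d f) (h : Function.Injective (velocity (𝓡 d) f)) :
    IsTorus d f.toMonoidHom.range := by
  obtain ⟨n, b, hb⟩ := exists_mem_ker_iff_repr_int f
    (eventually_ne_one_of_velocity_injective (hf.mdifferentiable 0) h) hf.span_ker
  let e := b.equivFun.symm.toContinuousLinearEquiv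
  refine ⟨n, f ∘ e, hf.contMDiff.comp e.contDiff.contMDiff, ?_, fun x => ?_,
    e.surjective.range_comp f⟩
  · intro x y
    simp [f.map_add_eq_mul]
  · have hrepr : ∀ i, b.repr (e x) i = x i := congrFun (b.equivFun.apply_symm_apply x)
    simp only [Function.comp_apply, hb, hrepr]

variable (d) in
/-- The image of the velocity, as a subspace of the model space of `G`: unlike the tangent space at
`1`, the model space is a normed space, so that its subspaces can be sources of smooth maps. -/
def velocityRange (f : AddChar F G) : Submodule ℝ (EuclideanSpace ℝ (Fin d)) :=
  LinearMap.range (velocity (𝓡 d) f : F →L[ℝ] EuclideanSpace ℝ (Fin d)).toLinearMap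

variable [LieGroup (𝓡 d) ∞ G]

theorem range_le_range_of_velocityRange_le (hf : MDifferentiable 𝓘(ℝ, F) (𝓡 d) f)
    (hf' : MDifferentiable 𝓘(ℝ, F') (𝓡 d) f') (h : velocityRange d f ≤ velocityRange d f') :
    f.toMonoidHom.range ≤ f'.toMonoidHom.range := by
  rintro _ ⟨x, rfl⟩
  obtain ⟨y, hy⟩ := h ⟨x, rfl⟩
  exact ⟨y, eq_of_velocity_eq hf' hf hy⟩

theorem IsTorusCover.exists_velocity_eq_self (hf : IsTorusCover d f) :
    ∃ f₀ : AddChar (velocityRange d f) G, IsTorusCover d f₀ ∧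
      (∀ X, velocity (𝓡 d) f₀ X = X.1) ∧
      f₀.toMonoidHom.range = f.toMonoidHom.range := by
  let q : F →ₗ[ℝ] velocityRange d f := LinearMap.rangeRestrict _
  have hq : Function.Surjective q := LinearMap.surjective_rangeRestrict _
  obtain ⟨s, hs⟩ := q.exists_rightInverse_of_surjective (LinearMap.range_eq_top.2 hq)
  let f₀ := f.compAddMonoidHom (s.toContinuousLinearMap : velocityRange d f →+ F)
  have hvelocity_s (X : velocityRange d f) : velocity (𝓡 d) f (s X) = X.1 :=
    congrArg Subtype.val (LinearMap.congr_fun hs X)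
  have hf₀q (x : F) : f₀ (q x) = f x :=
    eq_of_velocity_eq hf.mdifferentiable hf.mdifferentiable (hvelocity_s (q x))
  refine ⟨f₀, ⟨hf.contMDiff.comp s.toContinuousLinearMap.contMDiff,
    span_ker_eq_top_of_comp hq hf₀q hf.span_ker⟩, fun X => ?_, le_antisymm ?_ ?_⟩
  · rw [velocity_compAddMonoidHom hf.mdifferentiable]
    exact hvelocity_s X
  · rintro _ ⟨X, rfl⟩
    exact ⟨s X, rfl⟩
  · rintro _ ⟨x, rfl⟩
    exact ⟨q x, hf₀q x⟩

theorem IsTorusCover.isTorus_range (hf : IsTorusCover d f) : IsTorus d f.toMonoidHom.range := by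
  obtain ⟨f₀, hf₀, hvelocity, hrange⟩ := hf.exists_velocity_eq_self
  rw [← hrange]
  refine hf₀.isTorus_range_of_velocity_injective fun X Y h => Subtype.ext ?_
  exact (hvelocity X).symm.trans (h.trans (hvelocity Y))

theorem IsTorusCover.mulOfCommute (hf : IsTorusCover d f) (hf' : IsTorusCover d f')
    (h : ∀ x y, Commute (f x) (f' y)) : IsTorusCover d (mulOfCommute f f' h) where
  contMDiff :=
    (hf.contMDiff.comp contDiff_fst.contMDiff).mul (hf'.contMDiff.comp contDiff_snd.contMDiff)
  span_ker := by
    rw [eq_top_iff, ← LinearMap.sup_range_inl_inr, LinearMap.range_eq_map, LinearMap.range_eq_map,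
      ← hf.span_ker, ← hf'.span_ker, Submodule.map_span, Submodule.map_span, sup_le_iff]
    constructor <;> refine Submodule.span_mono ?_
    · rintro _ ⟨x, hx, rfl⟩
      simpa [LieToral.mulOfCommute] using hx
    · rintro _ ⟨x, hx, rfl⟩
      simpa [LieToral.mulOfCommute] using hx

theorem velocityRange_mulOfCommute (hf : IsTorusCover d f) (hf' : IsTorusCover d f')
    (h : ∀ x y, Commute (f x) (f' y)) :
    velocityRange d (mulOfCommute f f' h) = velocityRange d f ⊔ velocityRange d f' := by
  rw [velocityRange, velocity_mulOfCommute (hf.mulOfCommute hf' h).mdifferentiable]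
  exact LinearMap.range_coprod (velocity (𝓡 d) f : F →L[ℝ] EuclideanSpace ℝ (Fin d)).toLinearMap _

variable (d) in
/-- The tangent spaces at `1` of the tori contained in `C`. -/
def toralDirections (C : Subgroup G) : Set (Submodule ℝ (EuclideanSpace ℝ (Fin d))) :=
  {V | ∃ f : AddChar V G, IsTorusCover d f ∧ velocityRange d f = V ∧ f.toMonoidHom.range ≤ C}

theorem IsTorusCover.velocityRange_mem_toralDirections {C : Subgroup G} (hf : IsTorusCover d f)
    (hC : f.toMonoidHom.range ≤ C) : velocityRange d f ∈ toralDirections d C := by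
  obtain ⟨f₀, hf₀, hvelocity, hrange⟩ := hf.exists_velocity_eq_self
  refine ⟨f₀, hf₀, ?_, hrange.trans_le hC⟩
  ext X
  exact ⟨fun ⟨Y, hY⟩ => hY ▸ (hvelocity Y).symm ▸ Y.2, fun hX => ⟨⟨X, hX⟩, hvelocity ⟨X, hX⟩⟩⟩

theorem toralDirections_nonempty (C : Subgroup G) : (toralDirections d C).Nonempty := by
  have h1 : IsTorusCover d (1 : AddChar (Fin 0 → ℝ) G) :=
    ⟨contMDiff_const, Subsingleton.elim _ _⟩
  refine ⟨_, h1.velocityRange_mem_toralDirections ?_⟩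
  rintro _ ⟨x, rfl⟩
  exact C.one_mem

theorem supClosed_toralDirections {C : Subgroup G} (hC : ∀ x ∈ C, ∀ y ∈ C, Commute x y) :
    SupClosed (toralDirections d C) := by
  rintro V ⟨f, hf, hV, hfC⟩ W ⟨f', hf', hW, hf'C⟩
  have hcomm (x y) : Commute (f x) (f' y) := hC _ (hfC ⟨x, rfl⟩) _ (hf'C ⟨y, rfl⟩)
  have hmem := (hf.mulOfCommute hf' hcomm).velocityRange_mem_toralDirections (C := C) ?_
  · rwa [velocityRange_mulOfCommute hf hf', hV, hW] at hmem
  · rintro _ ⟨z, rfl⟩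
    exact C.mul_mem (hfC ⟨z.1, rfl⟩) (hf'C ⟨z.2, rfl⟩)

theorem exists_isGreatest_isTorus {C : Subgroup G} (hC : ∀ x ∈ C, ∀ y ∈ C, Commute x y) :
    ∃ T, IsGreatest {K | IsTorus d K ∧ K ≤ C} T := by
  obtain ⟨f, hf, hV, hfC⟩ : sSup (toralDirections d C) ∈ toralDirections d C :=
    CompleteLattice.WellFoundedGT.isSupClosedCompact _ inferInstance _ (toralDirections_nonempty C)
      (supClosed_toralDirections hC)
  refine ⟨f.toMonoidHom.range, ⟨hf.isTorus_range, hfC⟩, ?_⟩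
  rintro K ⟨hK, hKC⟩
  obtain ⟨n, f', hf', rfl⟩ := hK.exists_isTorusCover
  refine range_le_range_of_velocityRange_le hf'.mdifferentiable hf.mdifferentiable ?_
  rw [hV]
  exact le_sSup (hf'.velocityRange_mem_toralDirections hKC)

theorem isGreatest_toralComponent (H : Subgroup G) :
    IsGreatest {K | IsTorus d K ∧ K ≤ centerOf H} (toralComponent d H) := by
  obtain ⟨T, hT⟩ := exists_isGreatest_isTorus (d := d) (C := centerOf H)
    fun x hx y hy => centerOf_commute hx hy
  rwa [toralComponent, hT.isLUB.sSup_eq]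

end Tori

section Rigidity

variable {ι G : Type*} [Group G] {f : AddChar (ι → ℝ) G}

theorem pow_eq_one_iff_of_ker_eq_int (hker : ∀ x, f x = 1 ↔ ∀ i, ∃ m : ℤ, x i = m) (m : ℕ)
    (x : ι → ℝ) : f x ^ m = 1 ↔ ∀ i, ∃ z : ℤ, m * x i = z := by
  rw [← AddChar.map_nsmul_eq_pow, hker]
  simp only [Pi.smul_apply, nsmul_eq_mul]

theorem finite_torsion_range_of_ker_eq_int [Finite ι]
    (hker : ∀ x, f x = 1 ↔ ∀ i, ∃ m : ℤ, x i = m) {m : ℕ} (hm : 0 < m) :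
    {g ∈ f.toMonoidHom.range | g ^ m = 1}.Finite := by
  have hfinite : {r : ι → ℤ | ∀ i, r i ∈ Ico 0 (m : ℤ)}.Finite :=
    Finite.pi' fun _ => finite_Ico _ _
  refine (hfinite.image fun r => f fun i => r i / m).subset ?_
  rintro _ ⟨⟨x, rfl⟩, hx⟩
  choose z hz using (pow_eq_one_iff_of_ker_eq_int hker m x.toAdd).1 hx
  have hm' : (m : ℝ) ≠ 0 := by positivity
  refine ⟨fun i => z i % m,
    fun i => ⟨Int.emod_nonneg _ (by lia), Int.emod_lt_of_pos _ (by lia)⟩, ?_⟩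
  rw [← inv_mul_eq_one, ← AddChar.map_neg_eq_inv]
  refine (f.map_add_eq_mul _ x.toAdd).symm.trans ((hker _).2 fun i => ⟨z i / m, ?_⟩)
  have hdiv : ((z i % m : ℤ) : ℝ) + m * ((z i / m : ℤ) : ℝ) = z i := by
    exact_mod_cast Int.emod_add_mul_ediv (z i) m
  simp only [Pi.add_apply, Pi.neg_apply]
  field_simp
  linarith [hz i]

theorem range_subset_closure_torsion_of_ker_eq_int [Finite ι] [TopologicalSpace G]
    (hf : Continuous f) (hker : ∀ x, f x = 1 ↔ ∀ i, ∃ m : ℤ, x i = m) :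
    (f.toMonoidHom.range : Set G) ⊆ closure {g ∈ f.toMonoidHom.range | ∃ m > 0, g ^ m = 1} := by
  have := Fintype.ofFinite ι
  have hdense : DenseRange fun (q : ι → ℚ) i => (q i : ℝ) :=
    DenseRange.piMap fun _ => Rat.denseRange_cast
  refine (hf.range_subset_closure_image_dense hdense).trans (closure_mono ?_)
  rintro _ ⟨_, ⟨q, rfl⟩, rfl⟩
  refine ⟨⟨_, rfl⟩, ∏ i, (q i).den, Finset.prod_pos fun i _ => (q i).den_pos, ?_⟩
  refine (pow_eq_one_iff_of_ker_eq_int hker _ _).2 fun i => ?_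
  obtain ⟨c, hc⟩ := Finset.dvd_prod_of_mem (fun i => (q i).den) (Finset.mem_univ i)
  have hnum : (q i : ℝ) * (q i).den = (q i).num := by exact_mod_cast (q i).mul_den_eq_num
  refine ⟨c * (q i).num, ?_⟩
  rw [hc]
  push_cast
  rw [← hnum]
  ring

end Rigidity

section ToralComponent

variable {d : ℕ} {G : Type*} [TopologicalSpace G] [ChartedSpace (EuclideanSpace ℝ (Fin d)) G]
  [Group G] [LieGroup (𝓡 d) ∞ G]

theorem IsTorus.le_center_of_normal [PreconnectedSpace G] {K : Subgroup G} [K.Normal]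
    (hK : IsTorus d K) : K ≤ Subgroup.center G := by
  have := topologicalGroup_of_lieGroup (𝓡 d) ∞ (G := G)
  have := t2Space_of_lieGroup (𝓡 d) G (n := ∞)
  obtain ⟨n, f, hsmooth, hker, rfl⟩ := hK.exists_addChar
  exact le_center_of_finite_torsion_of_dense_torsion
    (fun m hm => finite_torsion_range_of_ker_eq_int hker hm)
    (range_subset_closure_torsion_of_ker_eq_int hsmooth.continuous hker)

theorem IsTorus.map_conj {K : Subgroup G} (hK : IsTorus d K) (g : G) :
    IsTorus d (K.map (MulAut.conj g).toMonoidHom) := by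
  obtain ⟨n, f, hsmooth, hadd, hker, hrange⟩ := hK
  refine ⟨n, fun x => g * f x * g⁻¹, (contMDiff_const.mul hsmooth).mul contMDiff_const,
    fun x y => ?_, fun x => ?_, ?_⟩
  · simp [hadd]
  · rw [conj_eq_one_iff, hker]
  · rw [Subgroup.coe_map, ← hrange, ← range_comp]
    rfl

instance toralComponent_normal {H : Subgroup G} [H.Normal] : (toralComponent d H).Normal := by
  have := centerOf_normal H
  obtain ⟨⟨htorus, hle⟩, hgreatest⟩ := isGreatest_toralComponent (d := d) H
  refine ⟨fun k hk g => hgreatest ⟨htorus.map_conj g, ?_⟩ ⟨k, hk, rfl⟩⟩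
  rintro _ ⟨k, hk, rfl⟩
  exact this.conj_mem k (hle hk) g

theorem IsTorus.le_nilpotentRadical {K : Subgroup G} (hK : IsTorus d K)
    (hcenter : K ≤ Subgroup.center G) : K ≤ nilpotentRadical d G := by
  obtain ⟨n, f, hf, rfl⟩ := hK.exists_isTorusCover
  rintro _ ⟨x, rfl⟩
  exact mem_nilpotentRadical_of_mem_center hf.mdifferentiable (fun t => hcenter ⟨t, rfl⟩) x

theorem toralComponent_top_eq [PreconnectedSpace G] {H : Subgroup G} [H.Normal]
    (hH : nilpotentRadical d G ≤ H) : toralComponent d ⊤ = toralComponent d H := by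
  have hTG := isGreatest_toralComponent (d := d) (⊤ : Subgroup G)
  have hTH := isGreatest_toralComponent (d := d) H
  rw [centerOf_top] at hTG
  refine le_antisymm (hTH.2 ⟨hTG.1.1, fun g hg => mem_centerOf.2 ⟨?_, fun h _ => ?_⟩⟩)
    (hTG.2 ⟨hTH.1.1, hTH.1.1.le_center_of_normal⟩)
  · exact hH (hTG.1.1.le_nilpotentRadical hTG.1.2 hg)
  · exact Subgroup.mem_center_iff.1 (hTG.1.2 hg) h

end ToralComponent

end LieToral

end

/-- For a connected Lie group `G`, the maximal torus `T(G)` of its center (which exists) coincides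
with the maximal tori of the centers of its solvable and nilpotent radicals. -/
theorem mainTheorem11 {d : ℕ} {G : Type*} [TopologicalSpace G]
    [ChartedSpace (EuclideanSpace ℝ (Fin d)) G] [Group G] [LieGroup (𝓡 d) ∞ G]
    [ConnectedSpace G] :
    LieToral.IsTorus d (LieToral.toralComponent d (⊤ : Subgroup G)) ∧
    LieToral.toralComponent d (⊤ : Subgroup G) =
      LieToral.toralComponent d (LieToral.solvableRadical d G) ∧
    LieToral.toralComponent d (LieToral.solvableRadical d G) =
      LieToral.toralComponent d (LieToral.nilpotentRadical d G) := by
  have hR := LieToral.toralComponent_top_eq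
    (LieToral.nilpotentRadical_le_solvableRadical (d := d) (G := G))
  have hN := LieToral.toralComponent_top_eq (le_refl (LieToral.nilpotentRadical d G))
  exact ⟨(LieToral.isGreatest_toralComponent ⊤).1.1, hR, hR.symm.trans hN⟩
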